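/- Monoids are commutative, cancellative and have a unit element; $\mathbb N=\{1,2,3,\dots\}$ and $\mathbb N_0=\mathbb N\cup\{0\}$. For a monoid $H$ with unit group $H^\times$ and $a\in H\setminus H^\times$, let $\mathsf L(a)$ be the set of all $k\in\mathbb N$ such that $a$ is a product of $k$ atoms (irreducible elements) of $H$; put $\mathsf L(a)=\{0\}$ for $a\in H^\times$, and let $\mathcal L(H)=\{\mathsf L(a)\mid a\in H\}$. $H$ is half-factorial if $|L|=1$ for all $L\in\mathcal L(H)$, and atomic if every non-unit is a finite product of atoms. $H$ is strongly primary if $\mathfrak m=H\setminus H^\times\neq\emptyset$ and for every $a\in\mathfrak m$ there is $n\in\mathbb N$ with $\mathfrak m^n\subset aH$. $H$ is locally tame if for every atom $u$ of $H_{\mathrm{red}}=H/H^\times$ there is $N\in\mathbb N_0$ such that, for every $a\in H$ having a factorization which contains $u$ and every factorization $z$ of $a$, there is a factorization $z'$ of $a$ which contains $u$ and satisfies $\mathsf d(z,z')\le N$. Here factorizations of $a$ are the elements $z$ of the free abelian monoid on the atoms of $H_{\mathrm{red}}$ with product $aH^\times$, and $\mathsf d(z,z')=\max\{|z\gcd(z,z')^{-1}|,\,|z'\gcd(z,z')^{-1}|\}$.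 For a subset $G_0$ of an additive abelian group, $\mathcal B(G_0)$ is the monoid of zero-sum sequences over $G_0$ (finite multisets of elements of $G_0$ with sum $0$), and $\mathcal L(G_0)=\mathcal L(\mathcal B(G_0))$. A homomorphism $\theta\colon H\to B$ to an atomic monoid $B$ is a weak transfer homomorphism if $B=B^\times\theta(H)B^\times$, $\theta^{-1}(B^\times)=H^\times$, and whenever $\theta(a)=v_1\cdots v_n$ with $a\in H$, $n\in\mathbb N$ and atoms $v_i$ of $B$, there are atoms $u_1,\dots,u_n$ of $H$ and a permutation $\tau$ of $\{1,\dots,n\}$ with $a=u_1\cdots u_n$ and $\theta(u_i)\in B^\times v_{\tau(i)}B^\times$ for all $i$. $H$ is transfer Krull if there is a weak transfer homomorphism $H\to\mathcal B(G_0)$ for some subset $G_0$ of some abelian group. A set $L\subset\mathbb Z$ is an AAMP with difference $d\in\mathbb N$, period $\mathcal D$ (where $\{0,d\}\subset\mathcal D\subset[0,d]$) and bound $M\in\mathbb N_0$ if $L=y+(L'\cup L^*\cup L'')\subset y+\mathcal D+d\mathbb Z$ for some $y\in\mathbb Z$, where $L^*$ is finite and nonempty, $\min L^*=0$, $L^*=(\mathcal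 D+d\mathbb Z)\cap[0,\max L^*]$, $L'\subset[-M,-1]$ and $L''\subset\max L^*+[1,M]$. A monoid $H$ satisfies the Structure Theorem for Sets of Lengths if it is atomic and there are $M\in\mathbb N_0$ and a finite nonempty set $\Delta\subset\mathbb N$ such that every $L\in\mathcal L(H)$ is an AAMP with some difference $d\in\Delta$ (and some period) and bound $M$. **Theorem 5.6.** Let $n\ge 1$ and let $D=D_1\times\dots\times D_n$ be the direct product of strongly primary monoids $D_1,\dots,D_n$, none of which is half-factorial. 1. For every finite nonempty set $L\subset\mathbb N$ there is $y_L\in\mathbb N_0$ such that $y+L\notin\mathcal L(D)$ for every integer $y\ge y_L$. 2. $\mathcal L(D)\ne\mathcal L(G_0)$ for every subset $G_0$ of every abelian group, and $D$ is not a transfer Krull monoid. If $D_1,\dots,D_n$ are locally tame, then $D$ satisfies the Structure Theorem for Sets of Lengths. -/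

import Mathlib

open scoped Pointwise

universe u v

namespace FactorizationTheory

/-! Monoids are multiplicatively written.  Throughout, the notions below are applied to cancellative
monoids; the atoms of a monoid are its elements satisfying Mathlib's `Irreducible`. -/

section Lengths

variable (H : Type u) [Monoid H]

/-- Every non-unit is a product of finitely many atoms. -/
def IsAtomicMonoid : Prop :=
  ∀ a : H, ¬ IsUnit a → ∃ l : List H, (∀ p ∈ l, Irreducible p) ∧ l.prod = a

variable {H} in
/-- The set of lengths `L(a)`: it is `{0}` for a unit, and otherwise the set of all `k` such that
`a` is a product of `k` atoms. -/
def setOfLengths (a : H) : Set ℕ :=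
  {k | (IsUnit a ∧ k = 0) ∨
    (¬ IsUnit a ∧ ∃ l : List H, (∀ p ∈ l, Irreducible p) ∧ l.prod = a ∧ l.length = k)}

/-- The system of sets of lengths `𝓛(H) = {L(a) | a ∈ H}`. -/
def systemOfLengths : Set (Set ℕ) :=
  Set.range (fun a : H => setOfLengths a)

/-- `H` is half-factorial: every `L ∈ 𝓛(H)` has exactly one element. -/
def IsHalfFactorial : Prop :=
  ∀ L ∈ systemOfLengths H, ∃ k : ℕ, L = {k}

end Lengths

/-- `H` is strongly primary: `𝔪 = H \ Hˣ` is nonempty, and for every `a ∈ 𝔪` there is a positive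
integer `n` with `𝔪 ^ n ⊆ a H` (`𝔪 ^ n` is the set of all products of `n` elements of `𝔪`). -/
def IsStronglyPrimary (H : Type u) [CommMonoid H] : Prop :=
  (nonunits H).Nonempty ∧
    ∀ a ∈ nonunits H, ∃ n : ℕ, 0 < n ∧ nonunits H ^ n ⊆ {x : H | a ∣ x}

section Tame

variable {H : Type u} [CommMonoid H]

/-- The set `Z(a)` of factorizations of `a`, a subset of the free abelian monoid on the atoms of
the reduced monoid `H_red = H / Hˣ`. -/
def factorizations (a : H) : Set (Multiset (Associates H)) :=
  {z | (∀ p ∈ z, Irreducible p) ∧ z.prod = Associates.mk a}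

open Classical in
/-- The distance `d(z, z') = max {|z / gcd(z, z')|, |z' / gcd(z, z')|}` of two factorizations. -/
noncomputable def factorizationDist (z z' : Multiset (Associates H)) : ℕ :=
  max (z - z').card (z' - z).card

variable (H) in
/-- `H` is locally tame: for every atom `u` of `H_red` the tame degree `t(H, u)` is finite, that is,
there is `N` such that, whenever `a` has a factorization containing `u`, every factorization of `a`
has distance at most `N` from some factorization of `a` containing `u`. -/
def IsLocallyTame : Prop :=
  ∀ u : Associates H, Irreducible u → ∃ N : ℕ, ∀ a : H,
    (∃ x ∈ factorizations a, u ∈ x) →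
      ∀ z ∈ factorizations a, ∃ z' ∈ factorizations a, u ∈ z' ∧ factorizationDist z z' ≤ N

end Tame

/-- `L` is an almost arithmetical multiprogression with difference `d`, period `P` and
bound `M`. -/
def IsAAMP (L : Set ℤ) (d : ℕ) (P : Set ℤ) (M : ℕ) : Prop :=
  0 < d ∧ {0, (d : ℤ)} ⊆ P ∧ P ⊆ Set.Icc 0 (d : ℤ) ∧
    ∃ (y m : ℤ) (L₁ Lc L₂ : Set ℤ),
      L = (fun x => y + x) '' (L₁ ∪ Lc ∪ L₂) ∧
      L₁ ∪ Lc ∪ L₂ ⊆ {x | ∃ p ∈ P, ∃ k : ℤ, x = p + d * k} ∧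
      Lc.Finite ∧ IsLeast Lc 0 ∧ IsGreatest Lc m ∧
      Lc = {x | ∃ p ∈ P, ∃ k : ℤ, x = p + d * k} ∩ Set.Icc 0 m ∧
      L₁ ⊆ Set.Icc (-(M : ℤ)) (-1) ∧ L₂ ⊆ Set.Icc (m + 1) (m + M)

/-- The Structure Theorem for Sets of Lengths holds for `H`: `H` is atomic, and there are a bound
`M` and a finite nonempty set `Δ` of positive integers such that every `L ∈ 𝓛(H)` is an AAMP with
bound `M` and some difference `d ∈ Δ`. -/
def SatisfiesStructureTheorem (H : Type u) [Monoid H] : Prop :=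
  IsAtomicMonoid H ∧ ∃ (M : ℕ) (Δ : Finset ℕ), Δ.Nonempty ∧ (∀ d ∈ Δ, 0 < d) ∧
    ∀ L ∈ systemOfLengths H, ∃ d ∈ Δ, ∃ P : Set ℤ, IsAAMP ((fun k : ℕ => (k : ℤ)) '' L) d P M

/-- The monoid `𝓑(G₀)` of zero-sum sequences over a subset `G₀` of an additive abelian group `G`,
inside the (multiplicatively written) free abelian monoid of all finite multisets over `G`. -/
def zeroSumMonoid {G : Type v} [AddCommGroup G] (G₀ : Set G) :
    Submonoid (Multiplicative (Multiset G)) where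
  carrier := {S | (∀ g ∈ S.toAdd, g ∈ G₀) ∧ S.toAdd.sum = 0}
  one_mem' := by simp
  mul_mem' := by
    rintro S T ⟨hS, hS0⟩ ⟨hT, hT0⟩
    refine ⟨fun g hg => ?_, ?_⟩
    · rw [toAdd_mul, Multiset.mem_add] at hg
      exact hg.elim (hS g) (hT g)
    · rw [toAdd_mul, Multiset.sum_add, hS0, hT0, add_zero]

/-- `θ : H → B` is a weak transfer homomorphism: `B` is atomic, `B = Bˣ θ(H) Bˣ`,
`θ⁻¹(Bˣ) = Hˣ`, and every factorization `θ(a) = v₁ ⋯ vₙ` into atoms (`n ≥ 1`) lifts, up to order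
and units, to a factorization `a = u₁ ⋯ uₙ` into atoms. -/
def IsWeakTransferHom {H : Type u} {B : Type v} [Monoid H] [Monoid B] (θ : H →* B) : Prop :=
  IsAtomicMonoid B ∧
  (∀ b : B, ∃ (e f : Bˣ) (a : H), b = e * θ a * f) ∧
  (∀ a : H, IsUnit (θ a) ↔ IsUnit a) ∧
  ∀ (a : H) (n : ℕ) (v : Fin n → B), 0 < n → (∀ i, Irreducible (v i)) →
    θ a = (List.ofFn v).prod →
      ∃ (w : Fin n → H) (τ : Equiv.Perm (Fin n)), (∀ i, Irreducible (w i)) ∧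
        a = (List.ofFn w).prod ∧ ∀ i, ∃ e f : Bˣ, θ (w i) = e * v (τ i) * f

/-- `H` is a transfer Krull monoid: it has a weak transfer homomorphism to `𝓑(G₀)` for some subset
`G₀` of some abelian group `G` (in the universe `v`). -/
def IsTransferKrull (H : Type u) [Monoid H] : Prop :=
  ∃ (G : Type v) (_ : AddCommGroup G) (G₀ : Set G) (θ : H →* zeroSumMonoid G₀),
    IsWeakTransferHom θ

end FactorizationTheory

open FactorizationTheory

/-! A strongly primary monoid which is not half-factorial has an element `c` with two different
lengths, and every element with a long factorization is divisible by a high power of `c`. So every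
set of lengths with a large element has a large diameter, a property which passes to finite
products, whereas the translates of a fixed finite set have constant diameter.

In contrast, if `G₀` carries a nontrivial zero-sum sequence, take one, `A`, of minimal support, and
then of minimal length. Every zero-sum sequence over its support has a power which is a power of
`A`, so `A` is the only atom dividing `A ^ k`, and `{k}` is a set of lengths for every `k`. Weak
transfer homomorphisms preserve systems of sets of lengths.

If a strongly primary monoid is locally tame, then cancelling a fixed atom `u` shifts lengths by a
bounded amount, and every element with a long factorization is divisible by `u`, so by induction
the gaps in sets of lengths are bounded. If `c` has lengths `k` and `k + d`, where `d` generates the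
group of all differences of lengths, then the lengths of `c ^ C` contain all `C * k + d * i` with
`i ≤ C`, and for large `C` these fill the gaps of the cofactor. So sets of lengths consist of full
residue classes modulo `d` up to a bounded distance from their end points. A sumset of two such sets
is again of this kind, since a long summand absorbs the irregularities of the other one. -/

namespace FactorizationTheory

section SetsOfLengths

variable {H : Type u} [CommMonoid H]

theorem mem_setOfLengths_iff {a : H} {k : ℕ} :
    k ∈ setOfLengths a ↔
      ∃ s : Multiset H, (∀ p ∈ s, Irreducible p) ∧ Associated s.prod a ∧ s.card = k := by
  constructor
  · rintro (⟨ha, rfl⟩ | ⟨_, l, hl, rfl, rfl⟩)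
    · exact ⟨0, by simp, (associated_one_iff_isUnit.2 ha).symm, rfl⟩
    · exact ⟨l, hl, by simp, rfl⟩
  · rintro ⟨s, hs, ⟨e, rfl⟩, rfl⟩
    induction s using Multiset.induction with
    | empty => exact Or.inl ⟨by simp, rfl⟩
    | cons p s _ =>
      obtain ⟨hp, hs⟩ := Multiset.forall_mem_cons.1 hs
      refine Or.inr ⟨fun hu => hp.not_isUnit ?_, (p * e) :: s.toList, ?_, ?_, by simp⟩
      · rw [Multiset.prod_cons, mul_assoc] at hu
        exact isUnit_of_mul_isUnit_left hu
      · simpa only [List.forall_mem_cons, Multiset.mem_toList, irreducible_mul_units]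
          using ⟨hp, hs⟩
      · rw [List.prod_cons, Multiset.prod_toList, Multiset.prod_cons, mul_right_comm]

theorem setOfLengths_congr {a b : H} (h : Associated a b) : setOfLengths a = setOfLengths b := by
  ext k
  simp only [mem_setOfLengths_iff, fun c : H => (⟨fun hc => hc.trans h, fun hc => hc.trans h.symm⟩ :
    Associated c a ↔ Associated c b)]

theorem zero_mem_setOfLengths_iff {a : H} : 0 ∈ setOfLengths a ↔ IsUnit a := by
  simpa [mem_setOfLengths_iff] using Associated.comm.trans associated_one_iff_isUnit

theorem setOfLengths_of_irreducible {a : H} (ha : Irreducible a) : setOfLengths a = {1} := by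
  refine Set.eq_singleton_iff_unique_mem.2
    ⟨mem_setOfLengths_iff.2 ⟨{a}, by simpa using ha, by simp, rfl⟩, fun k hk => ?_⟩
  obtain ⟨s, hs, hsa, rfl⟩ := mem_setOfLengths_iff.1 hk
  have hs0 : s ≠ 0 := by
    rintro rfl
    exact ha.not_isUnit (associated_one_iff_isUnit.1 hsa.symm)
  obtain ⟨p, hp⟩ := Multiset.exists_mem_of_ne_zero hs0
  obtain ⟨t, rfl⟩ := Multiset.exists_cons_of_mem hp
  have ht : IsUnit t.prod := ((hsa.irreducible_iff.2 ha).isUnit_or_isUnit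
    (Multiset.prod_cons p t)).resolve_left (hs p hp).not_isUnit
  have ht0 : t = 0 := Multiset.eq_zero_of_forall_notMem fun q hq =>
    (hs q (Multiset.mem_cons_of_mem hq)).not_isUnit (isUnit_of_dvd_unit (Multiset.dvd_prod hq) ht)
  simp [ht0]

theorem one_mem_setOfLengths_iff {a : H} : 1 ∈ setOfLengths a ↔ Irreducible a := by
  refine ⟨fun h => ?_, fun h => by simp [setOfLengths_of_irreducible h]⟩
  obtain ⟨s, hs, hsa, hcard⟩ := mem_setOfLengths_iff.1 h
  obtain ⟨p, rfl⟩ := Multiset.card_eq_one.1 hcard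
  rw [Multiset.prod_singleton] at hsa
  exact hsa.irreducible (hs p (Multiset.mem_singleton_self p))

theorem add_mem_setOfLengths {a b : H} {k l : ℕ} (hk : k ∈ setOfLengths a)
    (hl : l ∈ setOfLengths b) : k + l ∈ setOfLengths (a * b) := by
  rw [mem_setOfLengths_iff] at *
  obtain ⟨s, hs, hsa, rfl⟩ := hk
  obtain ⟨t, ht, htb, rfl⟩ := hl
  refine ⟨s + t, fun p hp => (Multiset.mem_add.1 hp).elim (hs p) (ht p), ?_, Multiset.card_add s t⟩
  rw [Multiset.prod_add]
  exact hsa.mul_mul htb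

theorem sum_mem_setOfLengths_prod {ι : Type*} (S : Finset ι) {a : ι → H} {k : ι → ℕ}
    (hk : ∀ i ∈ S, k i ∈ setOfLengths (a i)) : ∑ i ∈ S, k i ∈ setOfLengths (∏ i ∈ S, a i) := by
  classical
  induction S using Finset.induction_on with
  | empty => simp [zero_mem_setOfLengths_iff]
  | insert i S hi ih =>
    rw [Finset.sum_insert hi, Finset.prod_insert hi]
    obtain ⟨hki, hkS⟩ := Finset.forall_mem_insert .. |>.1 hk
    exact add_mem_setOfLengths hki (ih hkS)

theorem mul_mem_setOfLengths_pow {a : H} {k : ℕ} (hk : k ∈ setOfLengths a) (n : ℕ) :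
    n * k ∈ setOfLengths (a ^ n) := by
  simpa using sum_mem_setOfLengths_prod (Finset.range n) fun _ _ => hk

theorem map_mem_setOfLengths {K : Type*} [CommMonoid K] (f : H →* K)
    (hf : ∀ p, Irreducible p → Irreducible (f p)) {a : H} {k : ℕ} (hk : k ∈ setOfLengths a) :
    k ∈ setOfLengths (f a) := by
  obtain ⟨s, hs, hsa, rfl⟩ := mem_setOfLengths_iff.1 hk
  refine mem_setOfLengths_iff.2 ⟨s.map f, ?_, ?_, Multiset.card_map f s⟩
  · simpa only [Multiset.forall_mem_map_iff] using fun p hp => hf p (hs p hp)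
  · rw [← map_multiset_prod]
    exact hsa.map f

theorem isAtomicMonoid_iff_setOfLengths_nonempty :
    IsAtomicMonoid H ↔ ∀ a : H, (setOfLengths a).Nonempty := by
  constructor
  · intro h a
    by_cases ha : IsUnit a
    · exact ⟨0, zero_mem_setOfLengths_iff.2 ha⟩
    · obtain ⟨l, hl, hla⟩ := h a ha
      exact ⟨l.length, Or.inr ⟨ha, l, hl, hla, rfl⟩⟩
  · intro h a ha
    obtain ⟨k, ⟨ha', -⟩ | ⟨-, l, hl, hla, -⟩⟩ := h a
    · exact absurd ha' ha
    · exact ⟨l, hl, hla⟩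

theorem IsAtomicMonoid.exists_irreducible (h : IsAtomicMonoid H) {a : H} (ha : ¬ IsUnit a) :
    ∃ u : H, Irreducible u := by
  obtain ⟨_ | ⟨p, l⟩, hl, rfl⟩ := h a ha
  · exact absurd isUnit_one ha
  · exact ⟨p, hl p List.mem_cons_self⟩

theorem IsAtomicMonoid.exists_lt_of_not_isHalfFactorial (h : IsAtomicMonoid H)
    (hhf : ¬ IsHalfFactorial H) :
    ∃ c : H, ∃ k ∈ setOfLengths c, ∃ l ∈ setOfLengths c, k < l := by
  by_contra! hc
  refine hhf ?_
  rintro _ ⟨a, rfl⟩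
  obtain ⟨k, hk⟩ := isAtomicMonoid_iff_setOfLengths_nonempty.1 h a
  exact ⟨k, Set.eq_singleton_iff_unique_mem.2
    ⟨hk, fun l hl => le_antisymm (hc a k hk l hl) (hc a l hl k hk)⟩⟩

theorem setOfLengths_nonempty_of_card_le {a : H} {n : ℕ}
    (hn : ∀ s : Multiset H, (∀ p ∈ s, ¬ IsUnit p) → Associated s.prod a → s.card ≤ n) :
    (setOfLengths a).Nonempty := by
  let S : Set ℕ :=
    {m | ∃ s : Multiset H, (∀ p ∈ s, ¬ IsUnit p) ∧ Associated s.prod a ∧ s.card = m}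
  have hS : S.Nonempty := by
    by_cases ha : IsUnit a
    · exact ⟨0, 0, by simp, (associated_one_iff_isUnit.2 ha).symm, rfl⟩
    · exact ⟨1, {a}, by simpa using ha, by simp, rfl⟩
  have hSn : BddAbove S := ⟨n, by rintro _ ⟨s, hs, hsa, rfl⟩; exact hn s hs hsa⟩
  -- In a decomposition into a maximal number of non-units no factor can be split further.
  obtain ⟨_, ⟨s, hs, hsa, rfl⟩, hmax⟩ := hSn.exists_isGreatest_of_nonempty hS
  refine ⟨s.card, mem_setOfLengths_iff.2 ⟨s, fun p hp => ⟨hs p hp, fun x y hxy => ?_⟩, hsa, rfl⟩⟩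
  by_contra! hxy'
  obtain ⟨t, rfl⟩ := Multiset.exists_cons_of_mem hp
  have hsplit : (x ::ₘ y ::ₘ t).card ≤ (p ::ₘ t).card := by
    refine hmax ⟨x ::ₘ y ::ₘ t, ?_, ?_, rfl⟩
    · simp only [Multiset.forall_mem_cons] at hs ⊢
      exact ⟨hxy'.1, hxy'.2, hs.2⟩
    · simpa only [Multiset.prod_cons, hxy, mul_assoc] using hsa
  simp at hsplit

variable [IsCancelMul H]

theorem eq_of_associated_pow_pow {a : H} (ha : ¬ IsUnit a) {m n : ℕ}
    (h : Associated (a ^ m) (a ^ n)) : m = n := by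
  wlog hmn : m ≤ n generalizing m n
  · exact (this h.symm (le_of_not_ge hmn)).symm
  obtain ⟨r, rfl⟩ := Nat.exists_eq_add_of_le hmn
  obtain ⟨e, he⟩ := h
  rw [pow_add, mul_left_cancel_iff] at he
  by_contra hr
  exact ha ((isUnit_pow_iff (show r ≠ 0 by lia)).1 (he ▸ e.isUnit))

theorem setOfLengths_pow_eq_singleton {a : H} (ha : Irreducible a) {k : ℕ}
    (h : ∀ p, Irreducible p → p ∣ a ^ k → Associated p a) : setOfLengths (a ^ k) = {k} := by
  refine Set.eq_singleton_iff_unique_mem.2 ⟨?_, fun l hl => ?_⟩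
  · simpa using mul_mem_setOfLengths_pow (one_mem_setOfLengths_iff.2 ha) k
  obtain ⟨s, hs, hsa, rfl⟩ := mem_setOfLengths_iff.1 hl
  have hmap : s.map Associates.mk = Multiset.replicate s.card (Associates.mk a) := by
    refine Multiset.eq_replicate.2 ⟨Multiset.card_map _ s, ?_⟩
    simp only [Multiset.forall_mem_map_iff, Associates.mk_eq_mk_iff_associated]
    exact fun p hp => h p (hs p hp) ((Multiset.dvd_prod hp).trans hsa.dvd)
  refine eq_of_associated_pow_pow ha.not_isUnit (Associated.trans ?_ hsa)
  rw [← Associates.mk_eq_mk_iff_associated, ← Associates.prod_mk, hmap, Multiset.prod_replicate,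
    Associates.mk_pow]

end SetsOfLengths

section StronglyPrimary

variable {H : Type u} [CommMonoid H]

theorem IsStronglyPrimary.exists_dvd_prod (h : IsStronglyPrimary H) (a : H) :
    ∃ n : ℕ, ∀ s : Multiset H, (∀ p ∈ s, ¬ IsUnit p) → n ≤ s.card → a ∣ s.prod := by
  by_cases ha : IsUnit a
  · exact ⟨0, fun s _ _ => ha.dvd⟩
  obtain ⟨n, -, hn⟩ := h.2 a ha
  refine ⟨n, fun s hs hcard => ?_⟩
  have hmem : s.prod ∈ nonunits H ^ s.card := by
    simpa using Set.multiset_prod_mem_multiset_prod s (fun _ => nonunits H) id hs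
  rw [← Nat.add_sub_cancel' hcard, pow_add] at hmem
  obtain ⟨x, hx, y, -, hxy⟩ := Set.mem_mul.1 hmem
  exact hxy ▸ (hn hx).mul_right y

theorem IsStronglyPrimary.exists_dvd_of_mem_setOfLengths (h : IsStronglyPrimary H) (e : H) :
    ∃ n : ℕ, ∀ a : H, ∀ k ∈ setOfLengths a, n ≤ k → e ∣ a := by
  obtain ⟨n, hn⟩ := h.exists_dvd_prod e
  refine ⟨n, fun a k hk hnk => ?_⟩
  obtain ⟨s, hs, hsa, rfl⟩ := mem_setOfLengths_iff.1 hk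
  exact (hn s (fun p hp => (hs p hp).not_isUnit) hnk).trans hsa.dvd

variable [IsCancelMul H]

theorem IsStronglyPrimary.exists_card_le (h : IsStronglyPrimary H) (a : H) :
    ∃ n : ℕ, ∀ s : Multiset H, (∀ p ∈ s, ¬ IsUnit p) → Associated s.prod a → s.card ≤ n := by
  obtain ⟨n, hn⟩ := h.exists_dvd_prod a
  refine ⟨n, fun s hs hsa => ?_⟩
  by_contra! hlt
  obtain ⟨p, hp⟩ := Multiset.card_pos_iff_exists_mem.1 (Nat.zero_lt_of_lt hlt)
  obtain ⟨t, rfl⟩ := Multiset.exists_cons_of_mem hp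
  rw [Multiset.card_cons] at hlt
  have hdvd : a ∣ t.prod :=
    hn t (fun q hq => hs q (Multiset.mem_cons_of_mem hq)) (Nat.le_of_lt_succ hlt)
  obtain ⟨b, hb⟩ := hsa.dvd.trans hdvd
  rw [Multiset.prod_cons, mul_comm p, mul_assoc, left_eq_mul] at hb
  exact hs p hp (IsUnit.of_mul_eq_one b hb)

theorem IsStronglyPrimary.bddAbove_setOfLengths (h : IsStronglyPrimary H) (a : H) :
    BddAbove (setOfLengths a) := by
  obtain ⟨n, hn⟩ := h.exists_card_le a
  refine ⟨n, fun k hk => ?_⟩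
  obtain ⟨s, hs, hsa, rfl⟩ := mem_setOfLengths_iff.1 hk
  exact hn s (fun p hp => (hs p hp).not_isUnit) hsa

theorem IsStronglyPrimary.isAtomicMonoid (h : IsStronglyPrimary H) : IsAtomicMonoid H :=
  isAtomicMonoid_iff_setOfLengths_nonempty.2 fun a =>
    (h.exists_card_le a).elim fun _ hn => setOfLengths_nonempty_of_card_le hn

end StronglyPrimary

section Pi

variable {ι : Type*} {D : ι → Type u} [∀ i, CommMonoid (D i)]

theorem irreducible_pi_iff {p : ∀ i, D i} :
    Irreducible p ↔ ∃ i, Irreducible (p i) ∧ ∀ j ≠ i, IsUnit (p j) := by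
  classical
  constructor
  · intro hp
    obtain ⟨i, hi⟩ : ∃ i, ¬ IsUnit (p i) := by
      simpa only [Pi.isUnit_iff, not_forall] using hp.not_isUnit
    have hsplit (x y : D i) (hxy : p i = x * y) :
        IsUnit x ∨ IsUnit y ∧ ∀ j ≠ i, IsUnit (p j) := by
      have hp_eq :
          p = Function.update (1 : ∀ i, D i) i x * Function.update p i y := by
        rw [← Function.update_mul, one_mul, ← hxy, Function.update_eq_self]
      simpa [Pi.isUnit_iff, Function.forall_update_iff] using hp.isUnit_or_isUnit hp_eq
    exact ⟨i, ⟨hi, fun x y hxy => (hsplit x y hxy).imp id And.left⟩,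
      ((hsplit (p i) 1 (mul_one _).symm).resolve_left hi).2⟩
  · rintro ⟨i, hi, hj⟩
    refine ⟨fun h => hi.not_isUnit (Pi.isUnit_iff.1 h i), ?_⟩
    rintro x y rfl
    have hunit (j : ι) (hji : j ≠ i) : IsUnit (x j) ∧ IsUnit (y j) := IsUnit.mul_iff.1 (hj j hji)
    simp only [Pi.isUnit_iff]
    refine (hi.isUnit_or_isUnit rfl).imp (fun hx j => ?_) (fun hy j => ?_)
    · by_cases hji : j = i
      · exact hji ▸ hx
      · exact (hunit j hji).1
    · by_cases hji : j = i
      · exact hji ▸ hy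
      · exact (hunit j hji).2

theorem irreducible_mulSingle [DecidableEq ι] {i : ι} {x : D i} (hx : Irreducible x) :
    Irreducible (Pi.mulSingle i x : ∀ i, D i) :=
  irreducible_pi_iff.2 ⟨i, by simpa using hx, fun j hj => by simp [hj]⟩

theorem exists_sum_eq_card_of_associated_prod [Fintype ι] {s : Multiset (∀ i, D i)}
    (hs : ∀ p ∈ s, Irreducible p) {a : ∀ i, D i} (hsa : Associated s.prod a) :
    ∃ f : ι → ℕ, (∀ i, f i ∈ setOfLengths (a i)) ∧ ∑ i, f i = s.card := by
  classical
  induction s using Multiset.induction generalizing a with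
  | empty =>
    have ha : IsUnit a := associated_one_iff_isUnit.1 hsa.symm
    exact ⟨0, fun i => zero_mem_setOfLengths_iff.2 (Pi.isUnit_iff.1 ha i), by simp⟩
  | cons p s ih =>
    obtain ⟨hp, hs⟩ := Multiset.forall_mem_cons.1 hs
    obtain ⟨f, hf, hfs⟩ := ih hs (Associated.refl _)
    obtain ⟨i, hpi, hpj⟩ := irreducible_pi_iff.1 hp
    rw [Multiset.prod_cons] at hsa
    have ha (j : ι) : setOfLengths (a j) = setOfLengths (p j * s.prod j) :=
      setOfLengths_congr (hsa.symm.map (Pi.evalMonoidHom D j))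
    refine ⟨f + Pi.single i 1, fun j => ?_, by simp [Finset.sum_add_distrib, hfs]⟩
    rw [ha, add_comm]
    refine add_mem_setOfLengths ?_ (hf j)
    by_cases hj : j = i
    · subst hj
      simpa using one_mem_setOfLengths_iff.2 hpi
    · simpa [hj] using zero_mem_setOfLengths_iff.2 (hpj j hj)

theorem mem_setOfLengths_pi_iff [Fintype ι] {a : ∀ i, D i} {k : ℕ} :
    k ∈ setOfLengths a ↔ ∃ f : ι → ℕ, (∀ i, f i ∈ setOfLengths (a i)) ∧ ∑ i, f i = k := by
  classical
  constructor
  · intro hk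
    obtain ⟨s, hs, hsa, rfl⟩ := mem_setOfLengths_iff.1 hk
    exact exists_sum_eq_card_of_associated_prod hs hsa
  · rintro ⟨f, hf, rfl⟩
    rw [← Finset.univ_prod_mulSingle a]
    exact sum_mem_setOfLengths_prod Finset.univ fun i _ =>
      map_mem_setOfLengths (MonoidHom.mulSingle D i) (fun _ => irreducible_mulSingle) (hf i)

theorem setOfLengths_pi [Fintype ι] (a : ∀ i, D i) :
    setOfLengths a = ∑ i, setOfLengths (a i) := by
  ext k
  rw [mem_setOfLengths_pi_iff, Set.mem_fintype_sum]
  simp only [exists_prop]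

end Pi

section LengthSpread

/-- Elements of `H` with a long factorization have widely spread lengths: for every `r` there is
`n` such that a set of lengths which contains some length `≥ n` contains two lengths at distance
at least `r`. -/
def HasLargeLengthSpread (H : Type*) [Monoid H] : Prop :=
  ∀ r : ℕ, ∃ n : ℕ, ∀ a : H, ∀ x ∈ setOfLengths a, n ≤ x →
    ∃ k ∈ setOfLengths a, ∃ l ∈ setOfLengths a, k + r ≤ l

theorem IsStronglyPrimary.hasLargeLengthSpread {H : Type u} [CommMonoid H] [IsCancelMul H]
    (h : IsStronglyPrimary H) (hhf : ¬ IsHalfFactorial H) : HasLargeLengthSpread H := by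
  intro r
  have hat := h.isAtomicMonoid
  obtain ⟨c, k, hk, l, hl, hkl⟩ := hat.exists_lt_of_not_isHalfFactorial hhf
  obtain ⟨n, hdvd⟩ := h.exists_dvd_of_mem_setOfLengths (c ^ r)
  refine ⟨n, fun a x hx hnx => ?_⟩
  obtain ⟨b, rfl⟩ := hdvd a x hx hnx
  obtain ⟨y, hy⟩ := isAtomicMonoid_iff_setOfLengths_nonempty.1 hat b
  refine ⟨_, add_mem_setOfLengths (mul_mem_setOfLengths_pow hk r) hy,
    _, add_mem_setOfLengths (mul_mem_setOfLengths_pow hl r) hy, ?_⟩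
  calc r * k + y + r = r * (k + 1) + y := by ring
    _ ≤ r * l + y := by gcongr; exact hkl

theorem HasLargeLengthSpread.pi {ι : Type*} [Finite ι] {D : ι → Type u} [∀ i, CommMonoid (D i)]
    (h : ∀ i, HasLargeLengthSpread (D i)) : HasLargeLengthSpread (∀ i, D i) := by
  classical
  have := Fintype.ofFinite ι
  intro r
  choose n hn using fun i => h i r
  refine ⟨∑ i, n i + 1, fun a x hx hnx => ?_⟩
  obtain ⟨f, hf, rfl⟩ := mem_setOfLengths_pi_iff.1 hx
  obtain ⟨i, -, hi⟩ := Finset.exists_lt_of_sum_lt (Nat.lt_of_succ_le hnx)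
  obtain ⟨k, hk, l, hl, hkl⟩ := hn i (a i) (f i) (hf i) hi.le
  have hupdate {m : ℕ} (hm : m ∈ setOfLengths (a i)) :
      m + ∑ j ∈ Finset.univ \ {i}, f j ∈ setOfLengths a :=
    mem_setOfLengths_pi_iff.2 ⟨Function.update f i m,
      (Function.forall_update_iff f fun j m => m ∈ setOfLengths (a j)).2 ⟨hm, fun j _ => hf j⟩,
      Finset.sum_update_of_mem (Finset.mem_univ i) f m⟩
  exact ⟨_, hupdate hk, _, hupdate hl, by lia⟩

theorem HasLargeLengthSpread.exists_translate_notMem_systemOfLengths {H : Type*} [Monoid H]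
    (h : HasLargeLengthSpread H) {L : Finset ℕ} (hL : L.Nonempty) :
    ∃ yL : ℕ, ∀ y : ℕ, yL ≤ y → (fun l => y + l) '' (L : Set ℕ) ∉ systemOfLengths H := by
  obtain ⟨n, hn⟩ := h (L.sup id + 1)
  refine ⟨n, fun y hy => ?_⟩
  rintro ⟨a, ha : setOfLengths a = _⟩
  obtain ⟨l₀, hl₀⟩ := hL
  obtain ⟨k, hk, l, hl, hkl⟩ :=
    hn a (y + l₀) (ha ▸ Set.mem_image_of_mem _ hl₀) (hy.trans (Nat.le_add_right y l₀))
  rw [ha] at hk hl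
  obtain ⟨k, -, rfl⟩ := hk
  obtain ⟨l, hl, rfl⟩ := hl
  have hl_le : l ≤ L.sup id := Finset.le_sup (f := id) hl
  lia

end LengthSpread

section ZeroSumSequences

theorem exists_mem_count_nsmul_le {α : Type*} [DecidableEq α] {A : Multiset α} (hA : A ≠ 0)
    (B : Multiset α) : ∃ g ∈ A, B.count g • A ≤ A.count g • B := by
  obtain ⟨g, hg, hmin⟩ := A.toFinset.exists_min_image (fun g => (B.count g / A.count g : ℚ))
    (Multiset.toFinset_nonempty.2 hA)
  simp only [Multiset.mem_toFinset] at hg hmin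
  refine ⟨g, hg, Multiset.le_iff_count.2 fun x => ?_⟩
  rw [Multiset.count_nsmul, Multiset.count_nsmul]
  by_cases hx : x ∈ A
  · have hratio := hmin x hx
    have hcount {y : α} (hy : y ∈ A) : (0 : ℚ) < A.count y := by
      exact_mod_cast Multiset.count_pos.2 hy
    rw [div_le_div_iff₀ (hcount hg) (hcount hx)] at hratio
    rw [mul_comm (A.count g)]
    exact_mod_cast hratio
  · simp [Multiset.count_eq_zero_of_notMem hx]

variable {G : Type v} [AddCommGroup G] {G₀ : Set G}

/-- The multiset of terms of a zero-sum sequence, written additively. -/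
def zeroSumMonoid.terms (B : zeroSumMonoid G₀) : Multiset G :=
  B.1.toAdd

namespace zeroSumMonoid

theorem terms_injective : Function.Injective (terms : zeroSumMonoid G₀ → Multiset G) :=
  fun _ _ h => Subtype.ext h

@[simp]
theorem terms_mul (A B : zeroSumMonoid G₀) : terms (A * B) = terms A + terms B :=
  rfl

@[simp]
theorem terms_pow (A : zeroSumMonoid G₀) (n : ℕ) : terms (A ^ n) = n • terms A :=
  rfl

@[simp]
theorem terms_eq_zero_iff {A : zeroSumMonoid G₀} : terms A = 0 ↔ A = 1 :=
  terms_injective.eq_iff' rfl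

theorem dvd_iff_terms_le {A B : zeroSumMonoid G₀} : A ∣ B ↔ terms A ≤ terms B := by
  constructor
  · rintro ⟨C, rfl⟩
    exact Multiset.le_add_right _ _
  · intro h
    obtain ⟨C, hC⟩ := Multiset.le_iff_exists_add.1 h
    have hsum : (terms A).sum + C.sum = 0 := by
      rw [← Multiset.sum_add, ← hC]
      exact B.2.2
    refine ⟨⟨Multiplicative.ofAdd C, fun g hg => B.2.1 g ?_, ?_⟩, terms_injective hC⟩
    · exact Multiset.mem_of_le (show C ≤ terms B from hC ▸ Multiset.le_add_left C _) hg
    · rwa [show (terms A).sum = 0 from A.2.2, zero_add] at hsum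

instance : Subsingleton (zeroSumMonoid G₀)ˣ where
  allEq := by
    have hone (e : (zeroSumMonoid G₀)ˣ) : (e : zeroSumMonoid G₀) = 1 := by
      have h0 := congrArg terms e.mul_inv
      rw [terms_mul, terms_eq_zero_iff.2 rfl] at h0
      exact terms_eq_zero_iff.1 (add_eq_zero.1 h0).1
    exact fun e f => Units.ext ((hone e).trans (hone f).symm)

theorem dvd_of_pow_dvd_pow {A B : zeroSumMonoid G₀} {n : ℕ} (hn : n ≠ 0) (h : A ^ n ∣ B ^ n) :
    A ∣ B := by
  classical
  simp only [dvd_iff_terms_le, terms_pow, Multiset.le_iff_count, Multiset.count_nsmul] at h ⊢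
  exact fun g => Nat.le_of_mul_le_mul_left (h g) (Nat.pos_of_ne_zero hn)

theorem eq_of_pow_eq_pow {A B : zeroSumMonoid G₀} (hA : Irreducible A) (hB : Irreducible B)
    {m n : ℕ} (hm : m ≠ 0) (hn : n ≠ 0) (h : A ^ m = B ^ n) : A = B := by
  wlog hmn : m ≤ n generalizing A B m n
  · exact (this hB hA hn hm h.symm (le_of_not_ge hmn)).symm
  have hdvd : B ∣ A := dvd_of_pow_dvd_pow hm (h ▸ pow_dvd_pow B hmn)
  exact (associated_iff_eq.1 (hB.associated_of_dvd hA hdvd)).symm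

theorem exists_irreducible_minimal_support (h : ∃ B : zeroSumMonoid G₀, B ≠ 1) :
    ∃ A : zeroSumMonoid G₀, Irreducible A ∧
      ∀ B : zeroSumMonoid G₀, B ≠ 1 → terms B ⊆ terms A → terms A ⊆ terms B := by
  classical
  let size (B : zeroSumMonoid G₀) : ℕ ×ₗ ℕ := toLex ((terms B).toFinset.card, (terms B).card)
  obtain ⟨A, hA, hmin⟩ := exists_minimalFor_of_wellFoundedLT (· ≠ 1) size h
  have hsize (B : zeroSumMonoid G₀) (hB : B ≠ 1) : size A ≤ size B :=
    le_of_not_gt fun hlt => (hmin hB hlt.le).not_gt hlt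
  refine ⟨A, ⟨fun hu => hA (isUnit_iff_eq_one.1 hu), fun X Y hXY => ?_⟩, fun B hB hBA => ?_⟩
  · by_contra! hunit
    simp only [isUnit_iff_eq_one] at hunit
    refine (hsize X hunit.1).not_gt (Prod.Lex.toLex_lt_toLex'.2 ⟨?_, fun _ => ?_⟩)
    · refine Finset.card_le_card (Multiset.toFinset_subset.2 ?_)
      exact hXY ▸ Multiset.subset_of_le (Multiset.le_add_right _ _)
    · simpa [hXY, Multiset.card_pos] using hunit.2
  · have hcard : (terms A).toFinset.card ≤ (terms B).toFinset.card :=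
      (Prod.Lex.toLex_le_toLex'.1 (hsize B hB)).1
    rw [← Multiset.toFinset_subset] at hBA ⊢
    exact (Finset.eq_of_subset_of_card_le hBA hcard).ge

theorem exists_pow_eq_pow_of_minimal_support {A : zeroSumMonoid G₀}
    (hA : ∀ B : zeroSumMonoid G₀, B ≠ 1 → terms B ⊆ terms A → terms A ⊆ terms B) (hA1 : A ≠ 1)
    {B : zeroSumMonoid G₀} (hB : B ≠ 1) (hBA : terms B ⊆ terms A) :
    ∃ m n : ℕ, m ≠ 0 ∧ n ≠ 0 ∧ B ^ m = A ^ n := by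
  classical
  obtain ⟨g, hg, hle⟩ := exists_mem_count_nsmul_le (terms_eq_zero_iff.not.2 hA1) (terms B)
  have hdvd : A ^ (terms B).count g ∣ B ^ (terms A).count g := dvd_iff_terms_le.2 hle
  obtain ⟨C, hC⟩ := hdvd
  have hterms := congrArg terms hC
  simp only [terms_mul, terms_pow] at hterms
  have hgC : g ∉ terms C := by
    have hcount := congrArg (Multiset.count g) hterms
    simp only [Multiset.count_add, Multiset.count_nsmul, mul_comm ((terms B).count g)] at hcount
    exact Multiset.count_eq_zero.1 (by lia)
  have hCB : terms C ⊆ terms B := fun x hx =>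
    Multiset.mem_of_mem_nsmul (hterms ▸ Multiset.mem_add.2 (Or.inr hx))
  have hC1 : C = 1 := by
    by_contra hC1
    exact hgC (hA C hC1 (Multiset.Subset.trans hCB hBA) hg)
  exact ⟨_, _, Multiset.count_ne_zero.2 hg, Multiset.count_ne_zero.2 (hA B hB hBA hg),
    by rw [hC, hC1, mul_one]⟩

theorem singleton_mem_systemOfLengths (h : ∃ B : zeroSumMonoid G₀, B ≠ 1) (k : ℕ) :
    {k} ∈ systemOfLengths (zeroSumMonoid G₀) := by
  obtain ⟨A, hA, hmin⟩ := exists_irreducible_minimal_support h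
  refine ⟨A ^ k, setOfLengths_pow_eq_singleton hA fun B hB hBA => associated_iff_eq.2 ?_⟩
  have hsupp : terms B ⊆ terms A := fun g hg =>
    Multiset.mem_of_mem_nsmul (Multiset.subset_of_le (dvd_iff_terms_le.1 hBA) hg)
  obtain ⟨m, n, hm, hn, hpow⟩ := exists_pow_eq_pow_of_minimal_support hmin hA.ne_one hB.ne_one hsupp
  exact eq_of_pow_eq_pow hB hA hm hn hpow

end zeroSumMonoid

theorem HasLargeLengthSpread.systemOfLengths_ne_zeroSumMonoid {H : Type*} [CommMonoid H]
    (h : HasLargeLengthSpread H) {a : H} (ha : ¬ IsUnit a) (G₀ : Set G) :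
    systemOfLengths H ≠ systemOfLengths (zeroSumMonoid G₀) := by
  intro heq
  by_cases hne : ∃ B : zeroSumMonoid G₀, B ≠ 1
  · obtain ⟨y, hy⟩ := h.exists_translate_notMem_systemOfLengths (Finset.singleton_nonempty 1)
    apply hy y le_rfl
    simpa [heq] using zeroSumMonoid.singleton_mem_systemOfLengths hne (y + 1)
  · push Not at hne
    have hmem : setOfLengths a ∈ systemOfLengths H := Set.mem_range_self a
    obtain ⟨B, hB : setOfLengths B = setOfLengths a⟩ := heq ▸ hmem
    have h0 : 0 ∈ setOfLengths B := zero_mem_setOfLengths_iff.2 (hne B ▸ isUnit_one)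
    exact ha (zero_mem_setOfLengths_iff.1 (hB ▸ h0))

end ZeroSumSequences

section WeakTransfer

variable {H : Type u} {B : Type v} [CommMonoid H] [CommMonoid B] {θ : H →* B}

theorem IsWeakTransferHom.setOfLengths_map_subset (h : IsWeakTransferHom θ) (a : H) :
    setOfLengths (θ a) ⊆ setOfLengths a := by
  obtain ⟨-, -, hunit, hlift⟩ := h
  rintro k (⟨ha, rfl⟩ | ⟨ha, l, hl, hla, rfl⟩)
  · exact zero_mem_setOfLengths_iff.2 ((hunit a).1 ha)
  · have hl0 : 0 < l.length := List.length_pos_iff.2 fun h0 => ha (by simp [← hla, h0])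
    obtain ⟨w, -, hw, rfl, -⟩ := hlift a l.length l.get hl0 (fun i => hl _ (l.get_mem i))
      (by rw [List.ofFn_get, hla])
    refine Or.inr ⟨fun hu => ha ((hunit _).2 hu), List.ofFn w, ?_, rfl, List.length_ofFn⟩
    simpa [List.forall_mem_ofFn_iff] using hw

theorem IsWeakTransferHom.map_irreducible (h : IsWeakTransferHom θ) {p : H}
    (hp : Irreducible p) : Irreducible (θ p) := by
  obtain ⟨k, hk⟩ := isAtomicMonoid_iff_setOfLengths_nonempty.1 h.1 (θ p)
  have hk1 : k = 1 := by simpa [setOfLengths_of_irreducible hp] using h.setOfLengths_map_subset p hk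
  exact one_mem_setOfLengths_iff.1 (hk1 ▸ hk)

theorem IsWeakTransferHom.setOfLengths_map (h : IsWeakTransferHom θ) (a : H) :
    setOfLengths (θ a) = setOfLengths a :=
  (h.setOfLengths_map_subset a).antisymm fun _ hk =>
    map_mem_setOfLengths θ (fun _ => h.map_irreducible) hk

theorem IsWeakTransferHom.systemOfLengths_eq (h : IsWeakTransferHom θ) :
    systemOfLengths H = systemOfLengths B := by
  ext L
  constructor
  · rintro ⟨a, rfl⟩
    exact ⟨θ a, h.setOfLengths_map a⟩
  · rintro ⟨b, rfl⟩
    obtain ⟨e, f, a, rfl⟩ := h.2.1 b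
    refine ⟨a, (h.setOfLengths_map a).symm.trans (setOfLengths_congr ?_)⟩
    exact (associated_unit_mul_right (θ a) e e.isUnit).trans
      (associated_mul_unit_right _ (f : B) f.isUnit)

end WeakTransfer

section AlmostPeriodic

theorem exists_modEq_mem_Ico {d : ℕ} (hd : 0 < d) (a p : ℕ) :
    ∃ z ∈ Set.Ico p (p + d), z ≡ a [MOD d] := by
  refine ⟨p + (a + p * (d - 1)) % d, ⟨by lia, by gcongr; exact Nat.mod_lt _ hd⟩, ?_⟩
  calc p + (a + p * (d - 1)) % d ≡ p + (a + p * (d - 1)) [MOD d] := (Nat.mod_modEq _ _).add_left p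
    _ = a + d * p := by obtain ⟨e, rfl⟩ := Nat.exists_eq_add_one.2 hd; simp; ring
    _ ≡ a [MOD d] := by simp [Nat.ModEq]

/-- A nonempty finite set `A` of natural numbers is almost periodic with period `d` and bound `M`
if, at distance at least `M` from the end points of `A`, it is a union of residue classes
modulo `d`. The end points are replaced by arbitrary elements `b, c ∈ A`, which gives an equivalent
condition. -/
structure IsAlmostPeriodic (d M : ℕ) (A : Set ℕ) : Prop where
  nonempty : A.Nonempty
  bddAbove : BddAbove A
  mem_of_modEq : ∀ a ∈ A, ∀ b ∈ A, ∀ c ∈ A, ∀ x, x ≡ a [MOD d] → b + M ≤ x → x + M ≤ c → x ∈ A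

namespace IsAlmostPeriodic

variable {d M : ℕ} {A B : Set ℕ} {s t : ℕ}

theorem singleton (d M k : ℕ) : IsAlmostPeriodic d M {k} where
  nonempty := Set.singleton_nonempty k
  bddAbove := bddAbove_singleton
  mem_of_modEq := by
    rintro a - _ rfl _ rfl x - hbx hxc
    exact Set.mem_singleton_iff.2 (by lia)

theorem mono (hA : IsAlmostPeriodic d M A) {d' M' : ℕ} (hd : d ∣ d') (hM : M ≤ M') :
    IsAlmostPeriodic d' M' A where
  nonempty := hA.nonempty
  bddAbove := hA.bddAbove
  mem_of_modEq a ha b hb c hc x hxa hbx hxc :=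
    hA.mem_of_modEq a ha b hb c hc x (hxa.of_dvd hd) (by lia) (by lia)

theorem exists_isLeast_isGreatest (hA : IsAlmostPeriodic d M A) :
    ∃ s t, IsLeast A s ∧ IsGreatest A t :=
  let ⟨s, hs⟩ := (OrderBot.bddBelow A).exists_isLeast_of_nonempty hA.nonempty
  let ⟨t, ht⟩ := hA.bddAbove.exists_isGreatest_of_nonempty hA.nonempty
  ⟨s, t, hs, ht⟩

theorem exists_modEq_near (hA : IsAlmostPeriodic d M A) (hd : 0 < d) (hs : IsLeast A s)
    (ht : IsGreatest A t) {a q : ℕ} (ha : a ∈ A) (hsq : s ≤ q) (hqt : q ≤ t) :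
    ∃ z ∈ A, z ≡ a [MOD d] ∧ z ≤ q + (2 * M + d) ∧ q ≤ z + (2 * M + d) := by
  have hsa : s ≤ a := hs.2 ha
  have hat : a ≤ t := ht.2 ha
  by_cases hwide : s + (2 * M + d) ≤ t
  · obtain ⟨z, ⟨hz, hz'⟩, hza⟩ := exists_modEq_mem_Ico hd a (max (s + M) (min q (t - (M + d))))
    exact ⟨z, hA.mem_of_modEq a ha s hs.1 t ht.1 z hza (by lia) (by lia), hza, by lia, by lia⟩
  · exact ⟨a, ha, rfl, by lia, by lia⟩

theorem mem_add_of_wide (hA : IsAlmostPeriodic d M A) (hB : IsAlmostPeriodic d M B) (hd : 0 < d)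
    (hs : IsLeast A s) (ht : IsGreatest A t) {s' t' : ℕ} (hs' : s' ∈ B) (ht' : t' ∈ B)
    (hwide : s' + 2 * (3 * M + d) ≤ t') {a b x : ℕ} (ha : a ∈ A) (hb : b ∈ B)
    (hx : x ≡ a + b [MOD d]) (hsx : s + s' + (3 * M + d) ≤ x) (hxt : x + (3 * M + d) ≤ t + t') :
    x ∈ A + B := by
  have hst : s ≤ t := hs.2 ht.1
  obtain ⟨z, hzA, hza, hzq, hqz⟩ := hA.exists_modEq_near hd hs ht ha
    (q := max s (x + (3 * M + d) - t')) (le_max_left _ _) (by lia)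
  obtain ⟨y, rfl⟩ := Nat.exists_eq_add_of_le (show z ≤ x by lia)
  exact Set.add_mem_add hzA
    (hB.mem_of_modEq b hb s' hs' t' ht' y (hza.add_left_cancel hx) (by lia) (by lia))

theorem add (hA : IsAlmostPeriodic d M A) (hB : IsAlmostPeriodic d M B) (hd : 0 < d) :
    IsAlmostPeriodic d (2 * (3 * M + d)) (A + B) := by
  obtain ⟨s, t, hs, ht⟩ := hA.exists_isLeast_isGreatest
  obtain ⟨s', t', hs', ht'⟩ := hB.exists_isLeast_isGreatest
  refine ⟨hA.nonempty.add hB.nonempty, hA.bddAbove.add hB.bddAbove, ?_⟩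
  rintro _ ⟨a, ha, b, hb, rfl⟩ _ ⟨p, hp, p', hp', rfl⟩ _ ⟨q, hq, q', hq', rfl⟩ x hx hpx hxq
  have hsp : s + s' ≤ p + p' := add_le_add (hs.2 hp) (hs'.2 hp')
  have hqt : q + q' ≤ t + t' := add_le_add (ht.2 hq) (ht'.2 hq')
  by_cases hwide' : s' + 2 * (3 * M + d) ≤ t'
  · exact hA.mem_add_of_wide hB hd hs ht hs'.1 ht'.1 hwide' ha hb hx (by lia) (by lia)
  by_cases hwide : s + 2 * (3 * M + d) ≤ t
  · rw [add_comm A]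
    exact hB.mem_add_of_wide hA hd hs' ht' hs.1 ht.1 hwide hb ha (add_comm a b ▸ hx)
      (by lia) (by lia)
  · lia

theorem exists_sum {ι : Type*} (S : Finset ι) (hd : 0 < d) (M : ℕ) :
    ∃ M' : ℕ, ∀ A : ι → Set ℕ, (∀ i ∈ S, IsAlmostPeriodic d M (A i)) →
      IsAlmostPeriodic d M' (∑ i ∈ S, A i) := by
  classical
  induction S using Finset.induction_on with
  | empty => exact ⟨0, fun A _ => singleton d 0 0⟩
  | insert i S hi ih =>
    obtain ⟨M', hM'⟩ := ih
    refine ⟨2 * (3 * max M M' + d), fun A hA => ?_⟩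
    obtain ⟨hAi, hAS⟩ := Finset.forall_mem_insert .. |>.1 hA
    rw [Finset.sum_insert hi]
    exact (hAi.mono dvd_rfl (le_max_left M M')).add
      ((hM' A hAS).mono dvd_rfl (le_max_right M M')) hd

end IsAlmostPeriodic

theorem mem_iff_exists_mem_Icc_add_mul {R : Set ℤ} {d : ℤ} (hd : 0 < d)
    (hR : ∀ x y, x ≡ y [ZMOD d] → y ∈ R → x ∈ R) {x : ℤ} :
    x ∈ R ↔ ∃ p ∈ R ∩ Set.Icc 0 d, ∃ k : ℤ, x = p + d * k := by
  constructor
  · intro hx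
    exact ⟨x % d, ⟨hR _ _ (Int.mod_modEq x d) hx, Int.emod_nonneg x hd.ne',
      (Int.emod_lt_of_pos x hd).le⟩, x / d, (Int.emod_add_mul_ediv x d).symm⟩
  · rintro ⟨p, ⟨hp, -⟩, k, rfl⟩
    exact hR _ p (by simp [Int.ModEq]) hp

theorem exists_isAAMP_of_core {A : Set ℤ} {d M : ℕ} {y z : ℤ} (hd : 0 < d) (hy : y ∈ A)
    (hz : z ∈ A) (hyz : y ≤ z)
    (hcore : ∀ a ∈ A, ∀ x, x ≡ a [ZMOD d] → y ≤ x → x ≤ z → x ∈ A)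
    (hA : A ⊆ Set.Icc (y - M) (z + M)) : ∃ P, IsAAMP A d P M := by
  let B : Set ℤ := {x | y + x ∈ A}
  let R : Set ℤ := {x | ∃ a ∈ A, y + x ≡ a [ZMOD d]}
  have hBR (x : ℤ) (hx : x ∈ B) : x ∈ R := ⟨_, hx, rfl⟩
  have hR {x : ℤ} : x ∈ R ↔ ∃ p ∈ R ∩ Set.Icc 0 (d : ℤ), ∃ k : ℤ, x = p + d * k :=
    mem_iff_exists_mem_Icc_add_mul (by exact_mod_cast hd)
      fun _ _ hxx' hx' => hx'.imp fun _ ha => ⟨ha.1, (hxx'.add_left y).trans ha.2⟩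
  have hB (x : ℤ) (hx : x ∈ B) : -M ≤ x ∧ x ≤ z - y + M := by
    have := hA hx
    grind
  have hsplit : B ∩ Set.Iio 0 ∪ B ∩ Set.Icc 0 (z - y) ∪ B ∩ Set.Ioi (z - y) = B := by
    ext x
    grind
  refine ⟨R ∩ Set.Icc 0 d, hd, ?_, Set.inter_subset_right, y, z - y,
    B ∩ Set.Iio 0, B ∩ Set.Icc 0 (z - y), B ∩ Set.Ioi (z - y), ?_, ?_, ?_, ?_, ?_, ?_, ?_, ?_⟩
  · rintro p (rfl | rfl)
    · exact ⟨⟨y, hy, by simp⟩, by simp⟩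
    · exact ⟨⟨y, hy, by simp [Int.ModEq]⟩, by simp⟩
  · rw [hsplit]
    ext x
    simp [B]
  · rw [hsplit]
    exact fun x hx => hR.1 (hBR x hx)
  · exact (Set.finite_Icc 0 (z - y)).inter_of_right B
  · exact ⟨⟨by simpa [B] using hy, by simpa using hyz⟩, fun x hx => hx.2.1⟩
  · exact ⟨⟨by simpa [B] using hz, by simpa using hyz⟩, fun x hx => hx.2.2⟩
  · ext x
    refine and_congr_left fun hx => ⟨fun hxB => hR.1 (hBR x hxB), fun hxR => ?_⟩
    obtain ⟨a, ha, hxa⟩ := hR.2 hxR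
    exact hcore a ha (y + x) hxa (by grind) (by grind)
  · exact fun x hx => ⟨(hB x hx.1).1, Int.le_sub_one_of_lt hx.2⟩
  · exact fun x hx => ⟨Int.add_one_le_of_lt hx.2, (hB x hx.1).2⟩

theorem IsAlmostPeriodic.exists_isAAMP {d M : ℕ} {A : Set ℕ} (hA : IsAlmostPeriodic d M A)
    (hd : 0 < d) : ∃ P, IsAAMP ((fun k : ℕ => (k : ℤ)) '' A) d P (2 * (d * M)) := by
  obtain ⟨s, t, hs, ht⟩ := hA.exists_isLeast_isGreatest
  -- The core starts and ends at elements congruent to the end points of `A`.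
  obtain ⟨y, hy, z, hz, hyz, hsy, hzt, hcore⟩ : ∃ y ∈ A, ∃ z ∈ A, y ≤ z ∧ y ≤ s + 2 * (d * M) ∧
      t ≤ z + 2 * (d * M) ∧ ∀ a ∈ A, ∀ x, x ≡ a [MOD d] → y ≤ x → x ≤ z → x ∈ A := by
    have hM : M ≤ d * M := Nat.le_mul_of_pos_left M hd
    by_cases hwide : t ≤ s + 2 * (d * M)
    · refine ⟨s, hs.1, s, hs.1, le_rfl, by lia, hwide, fun _ _ x _ hsx hxs => ?_⟩
      exact le_antisymm hsx hxs ▸ hs.1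
    · obtain ⟨z, rfl⟩ := Nat.exists_eq_add_of_le' (show d * M ≤ t by lia)
      refine ⟨s + d * M, ?_, z, ?_, by lia, by lia, by lia, fun a ha x hxa hsx hxt => ?_⟩
      · exact hA.mem_of_modEq s hs.1 s hs.1 _ ht.1 _ (by simp [Nat.ModEq]) (by lia) (by lia)
      · exact hA.mem_of_modEq _ ht.1 s hs.1 _ ht.1 _ (by simp [Nat.ModEq]) (by lia) (by lia)
      · exact hA.mem_of_modEq a ha s hs.1 _ ht.1 x hxa (by lia) (by lia)
  refine exists_isAAMP_of_core hd (Set.mem_image_of_mem _ hy) (Set.mem_image_of_mem _ hz)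
    (by exact_mod_cast hyz) ?_ ?_
  · rintro _ ⟨a, ha, rfl⟩ x hxa hyx hxz
    lift x to ℕ using (Int.natCast_nonneg y).trans hyx
    exact ⟨x, hcore a ha x (Int.natCast_modEq_iff.1 hxa) (by exact_mod_cast hyx)
      (by exact_mod_cast hxz), rfl⟩
  · rintro _ ⟨a, ha, rfl⟩
    have hsa : s ≤ a := hs.2 ha
    have hat : a ≤ t := ht.2 ha
    simp only [Set.mem_Icc]
    lia

end AlmostPeriodic

section LocallyTame

variable {H : Type u} [CommMonoid H]

theorem irreducible_associatesMk_iff {a : H} : Irreducible (Associates.mk a) ↔ Irreducible a := by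
  simp only [irreducible_iff, Associates.isUnit_mk, Associates.forall_associated,
    Associates.mk_mul_mk, Associates.mk_eq_mk_iff_associated]
  refine and_congr_right fun _ => ⟨fun h x y hxy => h x y (hxy ▸ Associated.refl _), ?_⟩
  rintro h x y ⟨e, he⟩
  have ha : a = x * ↑e⁻¹ * y := by rw [mul_right_comm, Units.eq_mul_inv_iff_mul_eq, he]
  simpa only [Units.isUnit_mul_units] using h ha

theorem map_mk_mem_factorizations_iff {s : Multiset H} {a : H} :
    s.map Associates.mk ∈ factorizations a ↔
      (∀ p ∈ s, Irreducible p) ∧ Associated s.prod a := by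
  simp only [factorizations, Set.mem_ofPred_eq, Multiset.forall_mem_map_iff,
    irreducible_associatesMk_iff, Associates.prod_mk, Associates.mk_eq_mk_iff_associated]

theorem mem_setOfLengths_iff_factorizations {a : H} {k : ℕ} :
    k ∈ setOfLengths a ↔ ∃ z ∈ factorizations a, z.card = k := by
  rw [mem_setOfLengths_iff,
    (Multiset.map_surjective_of_surjective (Associates.mk_surjective (M := H))).exists]
  simp only [map_mk_mem_factorizations_iff, Multiset.card_map, and_assoc]

theorem factorizationDist_comm (z z' : Multiset (Associates H)) :
    factorizationDist z z' = factorizationDist z' z :=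
  max_comm _ _

theorem card_le_card_add_factorizationDist (z z' : Multiset (Associates H)) :
    z.card ≤ z'.card + factorizationDist z z' := by
  classical
  calc z.card ≤ (z' + (z - z')).card := Multiset.card_le_card le_add_tsub
    _ = z'.card + (z - z').card := Multiset.card_add _ _
    _ ≤ z'.card + factorizationDist z z' := by
      unfold factorizationDist
      gcongr
      convert le_max_left _ _

theorem add_mul_mem_setOfLengths_pow {c : H} {k d : ℕ} (hk : k ∈ setOfLengths c)
    (hkd : k + d ∈ setOfLengths c) {i n : ℕ} (hin : i ≤ n) :
    n * k + d * i ∈ setOfLengths (c ^ n) := by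
  obtain ⟨j, rfl⟩ := Nat.exists_eq_add_of_le hin
  rw [pow_add, show (i + j) * k + d * i = i * (k + d) + j * k by ring]
  exact add_mem_setOfLengths (mul_mem_setOfLengths_pow hkd i) (mul_mem_setOfLengths_pow hk j)

theorem mem_setOfLengths_pow_mul {b c : H} {k d n w x : ℕ} (hd : 0 < d)
    (hk : k ∈ setOfLengths c) (hkd : k + d ∈ setOfLengths c) (hw : w ∈ setOfLengths b)
    (hx : x ≡ n * k + w [MOD d]) (hle : n * k + w ≤ x) (hge : x ≤ n * k + w + d * n) :
    x ∈ setOfLengths (c ^ n * b) := by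
  obtain ⟨i, hi⟩ := (Nat.modEq_iff_dvd' hle).1 hx.symm
  have hin : i ≤ n := Nat.le_of_mul_le_mul_left (by lia) hd
  have hx_eq : x = n * k + d * i + w := by lia
  exact hx_eq ▸ add_mem_setOfLengths (add_mul_mem_setOfLengths_pow hk hkd hin) hw

variable (H) in
/-- The group of all differences `l - k` of two lengths `k, l` of the same element of `H`. -/
def lengthDifferences : AddSubgroup ℤ where
  carrier := {x | ∃ a : H, ∃ k ∈ setOfLengths a, ∃ l ∈ setOfLengths a, (l : ℤ) - k = x}
  zero_mem' :=
    have h0 : 0 ∈ setOfLengths (1 : H) := zero_mem_setOfLengths_iff.2 isUnit_one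
    ⟨1, 0, h0, 0, h0, sub_self _⟩
  add_mem' := by
    rintro _ _ ⟨a, k, hk, l, hl, rfl⟩ ⟨b, k', hk', l', hl', rfl⟩
    exact ⟨a * b, k + k', add_mem_setOfLengths hk hk', l + l', add_mem_setOfLengths hl hl',
      by push_cast; ring⟩
  neg_mem' := by
    rintro _ ⟨a, k, hk, l, hl, rfl⟩
    exact ⟨a, l, hl, k, hk, (neg_sub _ _).symm⟩

theorem exists_common_difference {b : H} {p q : ℕ} (hp : p ∈ setOfLengths b)
    (hq : q ∈ setOfLengths b) (hpq : p ≠ q) :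
    ∃ d, 0 < d ∧ (∃ c : H, ∃ k ∈ setOfLengths c, k + d ∈ setOfLengths c) ∧
      ∀ a : H, ∀ k ∈ setOfLengths a, ∀ l ∈ setOfLengths a, k ≡ l [MOD d] := by
  obtain ⟨g, hg⟩ := Int.subgroup_cyclic (lengthDifferences H)
  have hmem (x : ℤ) : x ∈ lengthDifferences H ↔ (g.natAbs : ℤ) ∣ x := by
    rw [hg, ← AddSubgroup.zmultiples_eq_closure, Int.mem_zmultiples_iff, Int.natAbs_dvd]
  have hmod (a : H) (k : ℕ) (hk : k ∈ setOfLengths a) (l : ℕ) (hl : l ∈ setOfLengths a) :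
      k ≡ l [MOD g.natAbs] :=
    Nat.modEq_iff_dvd.2 ((hmem _).1 ⟨a, k, hk, l, hl, rfl⟩)
  refine ⟨g.natAbs, Nat.pos_of_ne_zero fun h0 => hpq ?_, ?_, hmod⟩
  · exact Nat.modEq_zero_iff.1 (h0 ▸ hmod b p hp q hq)
  · obtain ⟨c, k, hk, l, hl, hkl⟩ := (hmem _).2 (dvd_refl _)
    have hl_eq : l = k + g.natAbs := by lia
    exact ⟨c, k, hk, hl_eq ▸ hl⟩

variable [IsCancelMul H]

theorem mk_cons_mem_factorizations_mul_iff {u a : H} (hu : Irreducible u)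
    {z : Multiset (Associates H)} :
    Associates.mk u ::ₘ z ∈ factorizations (u * a) ↔ z ∈ factorizations a := by
  obtain ⟨s, rfl⟩ := Multiset.map_surjective_of_surjective Associates.mk_surjective z
  rw [← Multiset.map_cons, map_mk_mem_factorizations_iff, map_mk_mem_factorizations_iff,
    Multiset.forall_mem_cons, and_iff_right hu, Multiset.prod_cons]
  refine and_congr_right fun _ => ⟨?_, fun h => h.mul_left u⟩
  rintro ⟨e, he⟩
  exact ⟨e, mul_left_cancel (by rwa [mul_assoc] at he)⟩

theorem IsLocallyTame.exists_length_near_of_irreducible (ht : IsLocallyTame H)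
    (hat : IsAtomicMonoid H) {u : H} (hu : Irreducible u) :
    ∃ N : ℕ, ∀ a : H, ∀ k ∈ setOfLengths (u * a),
      ∃ l ∈ setOfLengths a, k ≤ l + N ∧ l ≤ k + N := by
  obtain ⟨N, hN⟩ := ht (Associates.mk u) (irreducible_associatesMk_iff.2 hu)
  refine ⟨N + 1, fun a k hk => ?_⟩
  obtain ⟨z, hz, rfl⟩ := mem_setOfLengths_iff_factorizations.1 hk
  obtain ⟨m, hm⟩ := isAtomicMonoid_iff_setOfLengths_nonempty.1 hat a
  obtain ⟨x, hx, -⟩ := mem_setOfLengths_iff_factorizations.1 hm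
  obtain ⟨z', hz', huz', hdist⟩ := hN (u * a)
    ⟨_, (mk_cons_mem_factorizations_mul_iff hu).2 hx, Multiset.mem_cons_self _ _⟩ z hz
  obtain ⟨t, rfl⟩ := Multiset.exists_cons_of_mem huz'
  refine ⟨t.card, mem_setOfLengths_iff_factorizations.2
    ⟨t, (mk_cons_mem_factorizations_mul_iff hu).1 hz', rfl⟩, ?_⟩
  have hle := card_le_card_add_factorizationDist z (Associates.mk u ::ₘ t)
  have hge := card_le_card_add_factorizationDist (Associates.mk u ::ₘ t) z
  rw [factorizationDist_comm] at hge
  rw [Multiset.card_cons] at hle hge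
  lia

theorem IsLocallyTame.exists_length_near (ht : IsLocallyTame H) (hat : IsAtomicMonoid H) (e : H) :
    ∃ N : ℕ, ∀ a : H, ∀ k ∈ setOfLengths (e * a),
      ∃ l ∈ setOfLengths a, k ≤ l + N ∧ l ≤ k + N := by
  obtain ⟨m, hm⟩ := isAtomicMonoid_iff_setOfLengths_nonempty.1 hat e
  obtain ⟨s, hs, hse, -⟩ := mem_setOfLengths_iff.1 hm
  simp only [← setOfLengths_congr (hse.mul_right _)]
  clear hse
  induction s using Multiset.induction with
  | empty => exact ⟨0, fun a k hk => ⟨k, by simpa using hk, by simp⟩⟩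
  | cons p s ih =>
    obtain ⟨hp, hs⟩ := Multiset.forall_mem_cons.1 hs
    obtain ⟨N, hN⟩ := ht.exists_length_near_of_irreducible hat hp
    obtain ⟨N', hN'⟩ := ih hs
    refine ⟨N + N', fun a k hk => ?_⟩
    rw [Multiset.prod_cons, mul_assoc] at hk
    obtain ⟨l, hl, hkl⟩ := hN _ k hk
    obtain ⟨l', hl', hll'⟩ := hN' a l hl
    exact ⟨l', hl', by lia⟩

theorem IsStronglyPrimary.exists_gap_bound (h : IsStronglyPrimary H) (ht : IsLocallyTame H) :
    ∃ C : ℕ, ∀ a : H, ∀ k ∈ setOfLengths a, ∀ l ∈ setOfLengths a, ∀ x : ℕ, k ≤ x → x ≤ l →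
      ∃ w ∈ setOfLengths a, w ≤ x ∧ x ≤ w + C := by
  have hat := h.isAtomicMonoid
  obtain ⟨b, hb⟩ := h.1
  obtain ⟨u, hu⟩ := hat.exists_irreducible hb
  obtain ⟨n, hn⟩ := h.exists_dvd_of_mem_setOfLengths u
  obtain ⟨N, hN⟩ := ht.exists_length_near_of_irreducible hat hu
  refine ⟨n + N, fun a k hk l hl x hkx hxl => ?_⟩
  induction x generalizing a k l with
  | zero => exact ⟨k, hk, hkx, by lia⟩
  | succ x ih =>
    by_cases hxk : x + 1 ≤ k + (n + N)
    · exact ⟨k, hk, hkx, hxk⟩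
    obtain ⟨a, rfl⟩ := hn a l hl (by lia)
    obtain ⟨k', hk', hkk'⟩ := hN a k hk
    obtain ⟨l', hl', hll'⟩ := hN a l hl
    obtain ⟨w, hw, hwx⟩ : ∃ w ∈ setOfLengths a, w ≤ x ∧ x ≤ w + (n + N) := by
      by_cases hxl' : x ≤ l'
      · exact ih a k' hk' l' hl' (by lia) hxl'
      · exact ⟨l', hl', by lia⟩
    refine ⟨w + 1, ?_, by lia⟩
    rw [mul_comm]
    exact add_mem_setOfLengths hw (one_mem_setOfLengths_iff.2 hu)

/-- The sets of lengths of `H` are almost periodic with a common period and a common bound. -/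
def HasAlmostPeriodicLengths (H : Type*) [Monoid H] : Prop :=
  ∃ d M : ℕ, 0 < d ∧ ∀ a : H, IsAlmostPeriodic d M (setOfLengths a)

theorem IsHalfFactorial.hasAlmostPeriodicLengths {H : Type*} [Monoid H] (h : IsHalfFactorial H) :
    HasAlmostPeriodicLengths H := by
  refine ⟨1, 0, one_pos, fun a => ?_⟩
  obtain ⟨k, hk : setOfLengths a = {k}⟩ := h _ ⟨a, rfl⟩
  exact hk ▸ IsAlmostPeriodic.singleton 1 0 k

theorem IsStronglyPrimary.hasAlmostPeriodicLengths (h : IsStronglyPrimary H)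
    (ht : IsLocallyTame H) : HasAlmostPeriodicLengths H := by
  by_cases hhf : IsHalfFactorial H
  · exact hhf.hasAlmostPeriodicLengths
  have hat := h.isAtomicMonoid
  obtain ⟨b, p, hp, q, hq, hpq⟩ := hat.exists_lt_of_not_isHalfFactorial hhf
  obtain ⟨d, hd, ⟨c, k, hk, hkd⟩, hmod⟩ := exists_common_difference hp hq hpq.ne
  obtain ⟨C, hC⟩ := h.exists_gap_bound ht
  -- Every element with a long factorization is divisible by `c ^ C`, whose lengths fill an
  -- arithmetic progression with difference `d` that is longer than the gaps of the cofactor.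
  obtain ⟨n, hn⟩ := h.exists_dvd_of_mem_setOfLengths (c ^ C)
  obtain ⟨N, hN⟩ := ht.exists_length_near hat (c ^ C)
  refine ⟨d, n + N + C * k, hd, fun a => ⟨isAtomicMonoid_iff_setOfLengths_nonempty.1 hat a,
    h.bddAbove_setOfLengths a, fun y hy s hs t ht x hxy hsx hxt => ?_⟩⟩
  obtain ⟨a, rfl⟩ := hn a t ht (by lia)
  obtain ⟨s', hs', hss'⟩ := hN a s hs
  obtain ⟨t', ht', htt'⟩ := hN a t ht
  obtain ⟨w, hw, hwx, hxw⟩ := hC a s' hs' t' ht' (x - C * k) (by lia) (by lia)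
  have hCd : C ≤ d * C := Nat.le_mul_of_pos_left C hd
  have hyw : y ≡ C * k + w [MOD d] :=
    hmod _ y hy _ (add_mem_setOfLengths (mul_mem_setOfLengths_pow hk C) hw)
  exact mem_setOfLengths_pow_mul hd hk hkd hw (hxy.trans hyw) (by lia) (by lia)

theorem HasAlmostPeriodicLengths.pi {ι : Type*} [Finite ι] {D : ι → Type u}
    [∀ i, CommMonoid (D i)] (h : ∀ i, HasAlmostPeriodicLengths (D i)) :
    HasAlmostPeriodicLengths (∀ i, D i) := by
  have := Fintype.ofFinite ι
  choose d M hd hDM using h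
  have hd_pos : 0 < ∏ i, d i := Finset.prod_pos fun i _ => hd i
  obtain ⟨M', hM'⟩ := IsAlmostPeriodic.exists_sum (Finset.univ : Finset ι) hd_pos (∑ i, M i)
  refine ⟨∏ i, d i, M', hd_pos, fun a => ?_⟩
  rw [setOfLengths_pi]
  exact hM' _ fun i hi =>
    (hDM i (a i)).mono (Finset.dvd_prod_of_mem d hi) (Finset.single_le_sum_of_canonicallyOrdered hi)

theorem HasAlmostPeriodicLengths.satisfiesStructureTheorem {K : Type*} [CommMonoid K]
    (h : HasAlmostPeriodicLengths K) : SatisfiesStructureTheorem K := by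
  obtain ⟨d, M, hd, hAP⟩ := h
  refine ⟨isAtomicMonoid_iff_setOfLengths_nonempty.2 fun a => (hAP a).nonempty, 2 * (d * M), {d},
    Finset.singleton_nonempty d, by simpa using hd, ?_⟩
  rintro _ ⟨a, rfl⟩
  exact ⟨d, Finset.mem_singleton_self d, (hAP a).exists_isAAMP hd⟩

end LocallyTame

end FactorizationTheory

theorem theorem5p6_general {ι : Type*} [Finite ι] [Nonempty ι] (D : ι → Type u)
    [∀ i, CancelCommMonoid (D i)] (hprim : ∀ i, IsStronglyPrimary (D i)) :
    ((∀ i, ¬ IsHalfFactorial (D i)) →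
      (∀ L : Finset ℕ, L.Nonempty → ∃ yL : ℕ, ∀ y : ℕ, yL ≤ y →
        (fun l => y + l) '' (L : Set ℕ) ∉ systemOfLengths (∀ i, D i)) ∧
      (∀ (G : Type v) [AddCommGroup G] (G₀ : Set G),
        systemOfLengths (∀ i, D i) ≠ systemOfLengths (zeroSumMonoid G₀)) ∧
      ¬ IsTransferKrull.{_, v} (∀ i, D i)) ∧
    ((∀ i, IsLocallyTame (D i)) → SatisfiesStructureTheorem (∀ i, D i)) := by
  refine ⟨fun hnhf => ?_, fun ht => ?_⟩
  · have hspread := HasLargeLengthSpread.pi fun i => (hprim i).hasLargeLengthSpread (hnhf i)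
    choose a ha using fun i => (hprim i).1
    have ha_unit : ¬ IsUnit a := fun h => ha (Classical.arbitrary ι) (Pi.isUnit_iff.1 h _)
    refine ⟨fun L hL => hspread.exists_translate_notMem_systemOfLengths hL,
      fun G _ G₀ => hspread.systemOfLengths_ne_zeroSumMonoid ha_unit G₀, ?_⟩
    rintro ⟨G, _, G₀, θ, hθ⟩
    exact hspread.systemOfLengths_ne_zeroSumMonoid ha_unit G₀ hθ.systemOfLengths_eq
  · have hper := HasAlmostPeriodicLengths.pi fun i => (hprim i).hasAlmostPeriodicLengths (ht i)
    exact hper.satisfiesStructureTheorem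

theorem theorem5p6 (n : ℕ) (hn : 0 < n) (D : Fin n → Type u)
    [∀ i, CancelCommMonoid (D i)]
    (hprim : ∀ i, IsStronglyPrimary (D i))
    (hnhf : ∀ i, ¬ IsHalfFactorial (D i)) :
    (∀ L : Finset ℕ, L.Nonempty → (∀ l ∈ L, 0 < l) →
      ∃ yL : ℕ, ∀ y : ℕ, yL ≤ y →
        (fun l => y + l) '' (L : Set ℕ) ∉ systemOfLengths (∀ i, D i)) ∧
    (∀ (G : Type v) [AddCommGroup G] (G₀ : Set G),
      systemOfLengths (∀ i, D i) ≠ systemOfLengths (zeroSumMonoid G₀)) ∧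
    ¬ IsTransferKrull.{u, v} (∀ i, D i) ∧
    ((∀ i, IsLocallyTame (D i)) → SatisfiesStructureTheorem (∀ i, D i)) := by
  have : Nonempty (Fin n) := ⟨⟨0, hn⟩⟩
  obtain ⟨h, hstruct⟩ := theorem5p6_general.{u, v} D hprim
  obtain ⟨htranslate, hzeroSum, hkrull⟩ := h hnhf
  exact ⟨fun L hL _ => htranslate L hL, hzeroSum, hkrull, hstruct⟩
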